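/- **Setting.** Let $(\mathcal W,\otimes,I)$ be a *monoidally locally finitely presentable* category: a locally finitely presentable category with a monoidal structure such that $I$ is finitely presentable, $A\otimes B$ is finitely presentable whenever $A$ and $B$ are, every functor $-\otimes W$ preserves finite coproducts, and $\otimes$ preserves filtered colimits in each variable. (Coherence isomorphisms are suppressed below; $\mathcal W$ need not be strict.) Let $H:\mathcal W\to\mathcal W$ preserve filtered colimits and be equipped with a *point-strength*: morphisms $s^H_{(X,x),(Y,y)}:HX\otimes Y\to H(X\otimes Y)$, natural in pointed objects $x:I\to X$, $y:I\to Y$, with $s^H_{(X,x),(I,\mathrm{id})}=\mathrm{id}_{HX}$ and $s^H_{(X\otimes Y,x\otimes y),(Z,z)}\cdot(s^H_{(X,x),(Y,y)}\otimes Z)=s^H_{(X,x),(Y\otimes Z,y\otimes z)}$. An $H$-algebra $a:HA\to A$ is *completely iterative* if for every object $X$ and every $e:X\to HX+A$ there is a unique $e^\dagger:X\to A$ with $e^\dagger=[a,\mathrm{id}_A]\cdot(He^\dagger+\mathrm{id}_A)\cdot e$. A *free completely iterative $H$-algebra* on $X$ is a completely iterative algebra $\tau_X:HTX\to TX$ with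 $\eta^T_X:X\to TX$ such that every morphism from $X$ to a completely iterative algebra $B$ extends uniquely along $\eta^T_X$ to an algebra homomorphism $TX\to B$. An *$H$-monoid* is an $H$-algebra $(A,a)$ with a monoid structure $m:A\otimes A\to A$, $i:I\to A$ such that $m\cdot(a\otimes A)=a\cdot Hm\cdot s^H_{(A,i),(A,i)}$. Its homomorphisms are the monoid homomorphisms that are also $H$-algebra homomorphisms, and it is completely iterative if $(A,a)$ is. **Theorem 3.15.** Every object $X$ has a free completely iterative $H$-algebra $(TX,\tau_X,\eta^T_X)$. Let $\mathbb T=(T,\eta^T,\mu^T)$ be the resulting monad, where $\mu^T_X:TTX\to TX$ is the unique algebra homomorphism with $\mu^T_X\cdot\eta^T_{TX}=\mathrm{id}$. There is exactly one family $s^T_{(X,x),(Y,y)}:TX\otimes Y\to T(X\otimes Y)$, indexed by pairs of pointed objects, with $$s^T\cdot(\tau_X\otimes Y)=\tau_{X\otimes Y}\cdot Hs^T\cdot s^H_{(TX,\eta^T_X x),(Y,y)},\qquad s^T\cdot(\eta^T_X\otimes Y)=\eta^T_{X\otimes Y},$$ and this family is a point-strength of $T$. The algebra $(TI,\tau_I)$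 together with the unit $\eta^T_I:I\to TI$ and the multiplication $\mu^T_I\cdot s^T_{(I,\mathrm{id}),(TI,\eta^T_I)}:TI\otimes TI\to TI$ is an $H$-monoid, and it is the initial completely iterative $H$-monoid: for every completely iterative $H$-monoid $A$ there is exactly one $H$-monoid homomorphism $TI\to A$. -/

import Mathlib

open CategoryTheory CategoryTheory.Limits MonoidalCategory

universe v u

namespace HMon

/-! ## Monoidally locally finitely presentable categories -/

/-- A monoidal category is *monoidally locally finitely presentable* if it is locally finitely
presentable, its unit is finitely presentable, finitely presentable objects are closed under the
tensor product, every functor `- ⊗ W` preserves finite coproducts, and the tensor product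
preserves filtered colimits in each variable. The coherence isomorphisms of the monoidal category
are not required to be identities. -/
class IsMonoidallyLFP (C : Type u) [Category.{v} C] [MonoidalCategory C] : Prop
    extends IsLocallyFinitelyPresentable.{v} C where
  unit_fp : IsFinitelyPresentable.{v} (𝟙_ C)
  tensor_fp : ∀ A B : C, IsFinitelyPresentable.{v} A → IsFinitelyPresentable.{v} B →
    IsFinitelyPresentable.{v} (A ⊗ B)
  rightDistrib : ∀ W : C, PreservesFiniteCoproducts (tensorRight W)
  tensorLeft_finitary : ∀ W : C, PreservesFilteredColimits (tensorLeft W)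
  tensorRight_finitary : ∀ W : C, PreservesFilteredColimits (tensorRight W)

instance (C : Type u) [Category.{v} C] [MonoidalCategory C] [h : IsMonoidallyLFP C] :
    HasColimits C :=
  h.toIsCardinalLocallyPresentable.toHasColimitsOfSize

/-! ## Completely iterative algebras -/

section Cia

variable {C : Type u} [Category.{v} C] [HasBinaryCoproducts C] {H : C ⥤ C}

/-- `s : X ⟶ A` is a solution of the flat equation morphism `e : X ⟶ HX + A`
in the algebra `A`. -/
def IsSolution (A : Endofunctor.Algebra H) {X : C} (e : X ⟶ H.obj X ⨿ A.a) (s : X ⟶ A.a) : Prop :=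
  s = e ≫ coprod.map (H.map s) (𝟙 A.a) ≫ coprod.desc A.str (𝟙 A.a)

/-- Completely iterative algebras: every flat equation morphism has a unique solution. -/
def IsCia (A : Endofunctor.Algebra H) : Prop :=
  ∀ (X : C) (e : X ⟶ H.obj X ⨿ A.a), ∃! s : X ⟶ A.a, IsSolution A e s

variable (H) in
/-- A free completely iterative algebra on `Y`: a completely iterative algebra with a universal
arrow from `Y`. Morphisms of completely iterative algebras are all algebra homomorphisms. -/
structure FreeCia (Y : C) where
  alg : Endofunctor.Algebra H
  unit : Y ⟶ alg.a
  isCia : IsCia alg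
  universal : ∀ B : Endofunctor.Algebra H, IsCia B → ∀ f : Y ⟶ B.a,
    ∃! h : alg ⟶ B, unit ≫ h.f = f

namespace FreeCia

/-- The unique homomorphism from a free completely iterative algebra extending `f`. -/
noncomputable def lift {Y : C} (T : FreeCia H Y) {B : Endofunctor.Algebra H} (hB : IsCia B)
    (f : Y ⟶ B.a) : T.alg ⟶ B :=
  (T.universal B hB f).choose

lemma unit_lift {Y : C} (T : FreeCia H Y) {B : Endofunctor.Algebra H} (hB : IsCia B)
    (f : Y ⟶ B.a) : T.unit ≫ (T.lift hB f).f = f :=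
  (T.universal B hB f).choose_spec.1

lemma hom_ext {Y : C} (T : FreeCia H Y) {B : Endofunctor.Algebra H} (hB : IsCia B)
    {g h : T.alg ⟶ B} (w : T.unit ≫ g.f = T.unit ≫ h.f) : g = h :=
  (T.universal B hB (T.unit ≫ h.f)).unique w rfl

/-- The monad of free completely iterative algebras, for a choice of a free completely
iterative algebra on each object. Its multiplication at `X` is the unique homomorphism
`TTX ⟶ TX` extending the identity of `TX`. -/
@[simps]
noncomputable def monad (T : ∀ X : C, FreeCia H X) : Monad C where
  obj X := (T X).alg.a
  map {X Y} f := ((T X).lift (T Y).isCia (f ≫ (T Y).unit)).f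
  map_id X := by
    have h : (T X).lift (T X).isCia (𝟙 X ≫ (T X).unit) = 𝟙 (T X).alg :=
      (T X).hom_ext (T X).isCia (by simp [unit_lift])
    rw [h]; rfl
  map_comp {X Y Z} f g := by
    have h : (T X).lift (T Z).isCia ((f ≫ g) ≫ (T Z).unit) =
        (T X).lift (T Y).isCia (f ≫ (T Y).unit) ≫ (T Y).lift (T Z).isCia (g ≫ (T Z).unit) := by
      refine (T X).hom_ext (T Z).isCia ?_
      rw [Endofunctor.Algebra.comp_f, ← Category.assoc, unit_lift, unit_lift, Category.assoc,
        Category.assoc, unit_lift]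
    rw [h]; rfl
  η := { app := fun X => (T X).unit
         naturality := fun X Y f => ((T X).unit_lift (T Y).isCia (f ≫ (T Y).unit)).symm }
  μ := { app := fun X => ((T (T X).alg.a).lift (T X).isCia (𝟙 _)).f
         naturality := fun X Y f => by
           have h : (T (T X).alg.a).lift (T (T Y).alg.a).isCia
                 (((T X).lift (T Y).isCia (f ≫ (T Y).unit)).f ≫ (T (T Y).alg.a).unit) ≫
                 (T (T Y).alg.a).lift (T Y).isCia (𝟙 _) =
               (T (T X).alg.a).lift (T X).isCia (𝟙 _) ≫
                 (T X).lift (T Y).isCia (f ≫ (T Y).unit) := by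
             refine (T (T X).alg.a).hom_ext (T Y).isCia ?_
             rw [Endofunctor.Algebra.comp_f, Endofunctor.Algebra.comp_f, ← Category.assoc,
               ← Category.assoc, unit_lift, unit_lift, Category.assoc, unit_lift,
               Category.comp_id, Category.id_comp]
           exact congrArg (fun k => k.f) h }
  assoc X := by
    have h : (T (T (T X).alg.a).alg.a).lift (T (T X).alg.a).isCia
          (((T (T X).alg.a).lift (T X).isCia (𝟙 _)).f ≫ (T (T X).alg.a).unit) ≫
          (T (T X).alg.a).lift (T X).isCia (𝟙 _) =
        (T (T (T X).alg.a).alg.a).lift (T (T X).alg.a).isCia (𝟙 _) ≫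
          (T (T X).alg.a).lift (T X).isCia (𝟙 _) := by
      refine (T _).hom_ext (T X).isCia ?_
      rw [Endofunctor.Algebra.comp_f, Endofunctor.Algebra.comp_f, ← Category.assoc,
        ← Category.assoc, unit_lift, unit_lift, Category.assoc, unit_lift,
        Category.comp_id, Category.id_comp]
    exact congrArg (fun k => k.f) h
  left_unit X := (T (T X).alg.a).unit_lift (T X).isCia (𝟙 _)
  right_unit X := by
    have h : (T X).lift (T (T X).alg.a).isCia ((T X).unit ≫ (T (T X).alg.a).unit) ≫
        (T (T X).alg.a).lift (T X).isCia (𝟙 _) = 𝟙 (T X).alg := by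
      refine (T X).hom_ext (T X).isCia ?_
      rw [Endofunctor.Algebra.comp_f, ← Category.assoc, unit_lift, Category.assoc, unit_lift]
      rfl
    exact congrArg (fun k => k.f) h

end FreeCia

end Cia

/-! ## Point-strength -/

section Strength

variable {C : Type u} [Category.{v} C] [MonoidalCategory C]

/-- The unit object, pointed by its identity. -/
abbrev unitPt (C : Type u) [Category.{v} C] [MonoidalCategory C] : Under (𝟙_ C) :=
  Under.mk (𝟙 (𝟙_ C))

/-- The tensor product of pointed objects, with pointing `I ≅ I ⊗ I ⟶ X ⊗ Y`. -/
abbrev tensorPt (X Y : Under (𝟙_ C)) : Under (𝟙_ C) :=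
  Under.mk ((λ_ (𝟙_ C)).inv ≫ (X.hom ⊗ₘ Y.hom))

/-- A point-strength of an endofunctor `H`: morphisms `HX ⊗ Y ⟶ H(X ⊗ Y)`, natural in the pointed
objects `X` and `Y`, that satisfy the unit and the associativity axioms. -/
structure PointStrength (H : C ⥤ C) where
  app : ∀ X Y : Under (𝟙_ C), H.obj X.right ⊗ Y.right ⟶ H.obj (X.right ⊗ Y.right)
  naturality : ∀ {X X' Y Y' : Under (𝟙_ C)} (f : X ⟶ X') (g : Y ⟶ Y'),
    (H.map f.right ⊗ₘ g.right) ≫ app X' Y' = app X Y ≫ H.map (f.right ⊗ₘ g.right)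
  unit : ∀ X : Under (𝟙_ C),
    app X (unitPt C) ≫ H.map (ρ_ X.right).hom = (ρ_ (H.obj X.right)).hom
  assoc : ∀ X Y Z : Under (𝟙_ C),
    (app X Y ▷ Z.right) ≫ app (tensorPt X Y) Z ≫ H.map (α_ X.right Y.right Z.right).hom =
      (α_ (H.obj X.right) Y.right Z.right).hom ≫ app X (tensorPt Y Z)

/-- A family `t : TX ⊗ Y ⟶ T(X ⊗ Y)` for the monad of free completely iterative algebras is
*induced* by the point-strength `s` of `H` if, with the structures `τ : HTX ⟶ TX` and the
units `η : X ⟶ TX`, the following hold for all pointed `(X, x)` and `Y`: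
`t ∘ (τ ⊗ Y) = τ ∘ H t ∘ s` and `t ∘ (η ⊗ Y) = η`. Here `TX` is pointed by `η ∘ x`. -/
def IsInducedStrength [HasBinaryCoproducts C] {H : C ⥤ C} (s : PointStrength H)
    (T : ∀ X : C, FreeCia H X)
    (t : ∀ X Y : Under (𝟙_ C), (FreeCia.monad T).obj X.right ⊗ Y.right ⟶
      (FreeCia.monad T).obj (X.right ⊗ Y.right)) : Prop :=
  ∀ X Y : Under (𝟙_ C),
    ((T X.right).alg.str ▷ Y.right) ≫ t X Y =
      s.app (Under.mk (X.hom ≫ (T X.right).unit)) Y ≫ H.map (t X Y) ≫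
        (T (X.right ⊗ Y.right)).alg.str ∧
    ((T X.right).unit ▷ Y.right) ≫ t X Y = (T (X.right ⊗ Y.right)).unit

end Strength

/-! ## `H`-monoids -/

section HMonoid

variable {C : Type u} [Category.{v} C] [MonoidalCategory C] {H : C ⥤ C}

/-- Compatibility of an algebra structure and a monoid structure on the same object:
`m ∘ (a ⊗ A) = a ∘ H m ∘ s`, where `A` is pointed by the unit of the monoid. -/
def IsHMonoid (s : PointStrength H) (A : Endofunctor.Algebra H) (M : MonObj A.a) : Prop :=
  (A.str ▷ A.a) ≫ M.mul =
    s.app (Under.mk M.one) (Under.mk M.one) ≫ H.map M.mul ≫ A.str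

/-- An `H`-monoid for the point-strong endofunctor `(H, s)`. -/
structure HMonoid (s : PointStrength H) where
  alg : Endofunctor.Algebra H
  mon : MonObj alg.a
  isHMonoid : IsHMonoid s alg mon

attribute [instance] HMonoid.mon

namespace HMonoid

variable {s : PointStrength H}

/-- Homomorphisms of `H`-monoids: algebra homomorphisms that are monoid homomorphisms. -/
@[ext]
structure Hom (A B : HMonoid s) where
  algHom : A.alg ⟶ B.alg
  isMonHom : IsMonHom algHom.f

instance : Category (HMonoid s) where
  Hom A B := Hom A B
  id A := ⟨𝟙 A.alg, inferInstanceAs (IsMonHom (𝟙 A.alg.a))⟩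
  comp f g := ⟨f.algHom ≫ g.algHom,
    have := f.isMonHom
    have := g.isMonHom
    inferInstanceAs (IsMonHom (f.algHom.f ≫ g.algHom.f))⟩
  id_comp f := Hom.ext (Category.id_comp f.algHom)
  comp_id f := Hom.ext (Category.comp_id f.algHom)
  assoc f g h := Hom.ext (Category.assoc f.algHom g.algHom h.algHom)

/-- An `H`-monoid is completely iterative if its underlying algebra is. -/
def completelyIterative [HasBinaryCoproducts C] (s : PointStrength H) :
    ObjectProperty (HMonoid s) :=
  fun A => IsCia A.alg

end HMonoid

end HMonoid

end HMon

/-!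
# The initial completely iterative `H`-monoid

**Existence.** A free completely iterative algebra on `X` is the same as a terminal coalgebra for
the endofunctor `F = H(-) + X` (`IsTerminalCoalgebraAlg.freeCia`): a flat equation morphism
`Z ⟶ HZ + T` turns `Z + T` into an `F`-coalgebra, and its solutions are the coalgebra homomorphisms
`Z + T ⟶ T` that are the identity on `T`; and homomorphisms `T ⟶ B` extending `X ⟶ B` are the
solutions of the flat equation morphism `T ⟶ HT + X ⟶ HT + B`.

The terminal coalgebra is found as follows (`hasTerminal_coalgebra`). Let `κ` be an uncountable
regular cardinal, here `ℵ₁`. Then `C` is locally `κ`-presentable and `F` preserves `κ`-filtered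
colimits, so for a coalgebra `X` every partial lift of its structure to `κ`-presentable objects over
`X` extends one step further; the colimit of a countable chain of such extensions is a coalgebra
over `X` whose carrier is again `κ`-presentable (`PartialCoalgebra.exists_coalgebra`). Hence
every morphism from a `κ`-presentable object to `X` factorizes through a coalgebra with
`κ`-presentable carrier, in an essentially unique way, and this gives a homomorphism from `X` to the
colimit of all these coalgebras, which form an essentially small category. That colimit is therefore
weakly terminal; as coalgebras have all small colimits, a wide coequalizer of it is terminal.

**Strength and monoid structure.** Call `f : A ⊗ Y ⟶ B` a homomorphism in the first variable if
`f ∘ (A.str ⊗ Y) = B.str ∘ H f ∘ s` (`IsTensorHom`). Since `TX = HTX + X` and `- ⊗ Y` preserves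
binary coproducts, such homomorphisms `TX ⊗ Y ⟶ B` into a completely iterative `B` are the
solutions of a flat equation morphism, and so they correspond to arbitrary morphisms `X ⊗ Y ⟶ B`
(`existsUnique_isTensorHom`). The induced strength is the homomorphism in the first variable that
extends the unit of `T(X ⊗ Y)`, and the multiplication of `TI` the one that extends the left unitor.
Homomorphisms in the first variable are stable under composition with algebra homomorphisms, under
change of `Y` along pointed morphisms, and, by the associativity of `s`, under iteration
(`IsTensorHom.assoc`). So every equation required of the strength, of the monoid `TI`, and of the
morphism from it to another completely iterative `H`-monoid compares two homomorphisms in the first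
variable, and it is enough to check it on `X ⊗ Y`.
-/

namespace HMon

open Endofunctor

/-! ### Colimits of coalgebras -/

section CoalgebraColimits

variable {C : Type u} [Category.{v} C] {F : C ⥤ C} {J : Type*} [Category* J]

lemma coalgebra_str_factor {A B : Coalgebra F} (f : A ⟶ B) {Z : C} {a : A.V ⟶ Z} {b : B.V ⟶ Z}
    (h : f.f ≫ b = a) : f.f ≫ B.str ≫ F.map b = A.str ≫ F.map a := by
  rw [← h, F.map_comp, Coalgebra.Hom.h_assoc]

lemma coalgebra_hom_of_leg {A B : Coalgebra F} {L : C} {i : A.V ⟶ L} {l : L ⟶ F.obj L}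
    (hi : i ≫ l = A.str ≫ F.map i) (g : A ⟶ B) {m : L ⟶ B.V} (hm : i ≫ m = g.f) :
    i ≫ l ≫ F.map m = i ≫ m ≫ B.str := by
  rw [reassoc_of% hi, reassoc_of% hm, ← F.map_comp, hm, g.h]

/-- The coalgebra structure on the colimit, in the base category, of a diagram of coalgebras. -/
noncomputable def colimitCoalgebra (D : J ⥤ Coalgebra F)
    {c : Cocone (D ⋙ Coalgebra.forget F)} (hc : IsColimit c) : Coalgebra F where
  V := c.pt
  str := hc.desc
    { pt := F.obj c.pt
      ι :=
        { app j := (D.obj j).str ≫ F.map (c.ι.app j)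
          naturality j k f := by
            refine Eq.trans ?_ (Category.comp_id _).symm
            exact coalgebra_str_factor (D.map f) (c.w f) } }

lemma ι_colimitCoalgebra_str (D : J ⥤ Coalgebra F)
    {c : Cocone (D ⋙ Coalgebra.forget F)} (hc : IsColimit c) (j : J) :
    c.ι.app j ≫ (colimitCoalgebra D hc).str = (D.obj j).str ≫ F.map (c.ι.app j) :=
  hc.fac _ j

/-- The colimit cocone of a diagram of coalgebras, with vertex `colimitCoalgebra`. -/
noncomputable def colimitCoalgebraCocone (D : J ⥤ Coalgebra F)
    {c : Cocone (D ⋙ Coalgebra.forget F)} (hc : IsColimit c) : Cocone D where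
  pt := colimitCoalgebra D hc
  ι :=
    { app j :=
        { f := (c.ι.app j : (D.obj j).V ⟶ c.pt)
          h := (ι_colimitCoalgebra_str D hc j).symm }
      naturality j k f := by
        ext
        have h : (D.map f).f ≫ c.ι.app k = c.ι.app j := c.w f
        change (D.map f).f ≫ c.ι.app k = c.ι.app j ≫ 𝟙 _
        rw [h, Category.comp_id] }

/-- Colimits of coalgebras are computed in the base category. -/
noncomputable def isColimitColimitCoalgebraCocone (D : J ⥤ Coalgebra F)
    {c : Cocone (D ⋙ Coalgebra.forget F)} (hc : IsColimit c) :
    IsColimit (colimitCoalgebraCocone D hc) where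
  desc s :=
    { f := (hc.desc ((Coalgebra.forget F).mapCocone s) : c.pt ⟶ s.pt.V)
      h := by
        refine hc.hom_ext fun j => ?_
        exact coalgebra_hom_of_leg (ι_colimitCoalgebra_str D hc j) (s.ι.app j) (hc.fac _ j) }
  fac s j := by
    apply Coalgebra.ext
    exact hc.fac ((Coalgebra.forget F).mapCocone s) j
  uniq s m hm := by
    apply Coalgebra.ext
    exact hc.uniq ((Coalgebra.forget F).mapCocone s) (m.f : c.pt ⟶ s.pt.V)
      fun j => congrArg (fun k => k.f) (hm j)

instance [HasColimitsOfShape J C] : HasColimitsOfShape J (Coalgebra F) where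
  has_colimit D := ⟨_, isColimitColimitCoalgebraCocone D (colimit.isColimit _)⟩

end CoalgebraColimits

/-! ### Terminal coalgebras of accessible endofunctors -/

section Accessible

variable {C : Type u} [Category.{v} C] (κ : Cardinal.{v}) [Fact κ.IsRegular]
  [IsCardinalLocallyPresentable C κ] {F : C ⥤ C} [F.IsCardinalAccessible κ]

omit [Fact κ.IsRegular] in
lemma hasCardinalLT_arrow_nat (hκ : Cardinal.aleph0 < κ) : HasCardinalLT (Arrow ℕ) κ := by
  have : Countable (Arrow ℕ) :=
    Function.Injective.countable (f := fun a : Arrow ℕ => (a.left, a.right)) (by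
      rintro ⟨a, b, f⟩ ⟨a', b', f'⟩ h
      obtain ⟨rfl, rfl⟩ := Prod.mk.inj h
      obtain rfl := Subsingleton.elim f f'
      rfl)
  refine lt_of_le_of_lt (b := Cardinal.aleph0) ?_ (by simpa using hκ)
  simp

omit [F.IsCardinalAccessible κ] in
/-- The colimit of a chain `A₀ ⟶ A₁ ⟶ A₂ ⟶ ⋯` of `κ`-presentable objects over a coalgebra `X`,
with compatible lifts `Aₙ ⟶ F Aₙ₊₁` of the structure of `X`, is a coalgebra over `X`. -/
lemma exists_coalgebra_of_chain (hκ : Cardinal.aleph0 < κ) (X : Coalgebra F) (A : ℕ → C)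
    (u : ∀ n, A n ⟶ A (n + 1)) (d : ∀ n, A n ⟶ F.obj (A (n + 1))) (q : ∀ n, A n ⟶ X.V)
    (hA : ∀ n, IsCardinalPresentable (A n) κ)
    (hd : ∀ n, u n ≫ d (n + 1) = d n ≫ F.map (u (n + 1)))
    (hu : ∀ n, u n ≫ q (n + 1) = q n)
    (hq : ∀ n, d n ≫ F.map (q (n + 1)) = q n ≫ X.str) :
    ∃ (R : Coalgebra F) (r : R ⟶ X) (v : ∀ n, A n ⟶ R.V), IsCardinalPresentable R.V κ ∧
      (∀ n, v n ≫ r.f = q n) ∧ (∀ n, u n ≫ v (n + 1) ≫ R.str = d n ≫ F.map (v (n + 1))) := by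
  have : HasColimitsOfSize.{0, 0} C := hasColimitsOfSizeShrink.{0, 0, v, v} C
  let D : ℕ ⥤ C := Functor.ofSequence u
  have hmap (n : ℕ) : D.map (homOfLE n.le_succ) = u n := Functor.ofSequence_map_homOfLE_succ _ n
  let v (n : ℕ) : A n ⟶ colimit D := colimit.ι D n
  have hv (n : ℕ) : u n ≫ v (n + 1) = v n := by
    rw [← hmap]; exact colimit.w D (homOfLE n.le_succ)
  have hext {Z : C} {f g : colimit D ⟶ Z} (h : ∀ n, v n ≫ f = v n ≫ g) : f = g :=
    colimit.hom_ext h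
  have desc {Z : C} (f : ∀ n, A n ⟶ Z) (hf : ∀ n, u n ≫ f (n + 1) = f n) :
      ∃ g : colimit D ⟶ Z, ∀ n, v n ≫ g = f n :=
    ⟨colimit.desc D ⟨Z, NatTrans.ofSequence f fun n => by
      rw [hmap]; exact (hf n).trans (Category.comp_id _).symm⟩, fun n => colimit.ι_desc _ n⟩
  obtain ⟨str, hstr⟩ := desc (fun n => d n ≫ F.map (v (n + 1))) fun n => by
    rw [reassoc_of% hd, ← F.map_comp, hv]
  obtain ⟨r, hr⟩ := desc q hu
  refine ⟨⟨colimit D, str⟩, ⟨r, hext fun n => ?_⟩, v, ?_, hr, fun n => ?_⟩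
  · dsimp
    rw [reassoc_of% hstr, reassoc_of% hr, ← F.map_comp, hr, hq]
  · have (n : ℕ) : IsCardinalPresentable (D.obj n) κ := hA n
    exact isCardinalPresentable_of_isColimit _ (colimit.isColimit D) κ
      (hasCardinalLT_arrow_nat κ hκ)
  · dsimp
    rw [reassoc_of% hv, hstr]

/-- A partial coalgebra over the coalgebra `X`: a morphism `u : A ⟶ B` of `κ`-presentable
objects over `X` on which the structure of `X` has been lifted to `d : A ⟶ F B`. -/
structure PartialCoalgebra (X : Coalgebra F) where
  A : C
  B : C
  u : A ⟶ B
  q : B ⟶ X.V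
  d : A ⟶ F.obj B
  w : d ≫ F.map q = u ≫ q ≫ X.str
  hA : IsCardinalPresentable A κ
  hB : IsCardinalPresentable B κ

namespace PartialCoalgebra

variable {κ} {X : Coalgebra F}

/-- Since `X` is a `κ`-filtered colimit of `κ`-presentable objects and `F` preserves it, the
structure of `X` lifts one stage further, compatibly with the previous lift. -/
lemma exists_next (S : PartialCoalgebra κ X) :
    ∃ (B' : C) (u' : S.B ⟶ B') (q' : B' ⟶ X.V) (d' : S.B ⟶ F.obj B'),
      IsCardinalPresentable B' κ ∧ u' ≫ q' = S.q ∧ d' ≫ F.map q' = S.q ≫ X.str ∧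
        S.u ≫ d' = S.d ≫ F.map u' := by
  have := S.hA
  have := S.hB
  obtain ⟨J, _, _, ⟨p⟩⟩ :=
    (isCardinalFilteredGenerator_isCardinalPresentable C κ).exists_colimitsOfShape X.V
  have := isFiltered_of_isCardinalFiltered J κ
  have := F.preservesColimitsOfShape_of_isCardinalAccessible κ J
  have hF := isColimitOfPreserves F p.isColimit
  obtain ⟨j₁, a, ha⟩ := IsCardinalPresentable.exists_hom_of_isColimit κ hF (S.q ≫ X.str)
  obtain ⟨j₂, b, hb⟩ := IsCardinalPresentable.exists_hom_of_isColimit κ p.isColimit S.q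
  obtain ⟨j, f, g, -⟩ := IsFilteredOrEmpty.cocone_objs j₁ j₂
  dsimp at a ha b hb
  obtain ⟨k, t, ht⟩ := IsCardinalPresentable.exists_eq_of_isColimit' κ hF (i := j)
    (S.u ≫ a ≫ F.map (p.diag.map f)) (S.d ≫ F.map (b ≫ p.diag.map g)) (by
      have e₁ := p.w f
      have e₂ := p.w g
      dsimp
      simp only [Category.assoc, ← F.map_comp, e₁, e₂, ha, hb, S.w])
  dsimp at ht
  have e₁ := p.w (f ≫ t)
  have e₂ := p.w (g ≫ t)
  refine ⟨p.diag.obj k, b ≫ p.diag.map (g ≫ t), p.ι.app k, a ≫ F.map (p.diag.map (f ≫ t)),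
    p.prop_diag_obj k, ?_, ?_, ?_⟩
  · rw [Category.assoc, e₂, hb]
  · rw [Category.assoc, ← F.map_comp, e₁, ha]
  · simpa using ht

/-- A choice of extension of a partial coalgebra by one stage. -/
noncomputable def next (S : PartialCoalgebra κ X) : PartialCoalgebra κ X where
  A := S.B
  B := S.exists_next.choose
  u := S.exists_next.choose_spec.choose
  q := S.exists_next.choose_spec.choose_spec.choose
  d := S.exists_next.choose_spec.choose_spec.choose_spec.choose
  w := by
    obtain ⟨-, h₁, h₂, -⟩ := S.exists_next.choose_spec.choose_spec.choose_spec.choose_spec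
    rw [h₂, reassoc_of% h₁]
  hA := S.hB
  hB := S.exists_next.choose_spec.choose_spec.choose_spec.choose_spec.1

lemma next_u_q (S : PartialCoalgebra κ X) : S.next.u ≫ S.next.q = S.q :=
  S.exists_next.choose_spec.choose_spec.choose_spec.choose_spec.2.1

lemma u_next_d (S : PartialCoalgebra κ X) : S.u ≫ S.next.d = S.d ≫ F.map S.next.u :=
  S.exists_next.choose_spec.choose_spec.choose_spec.choose_spec.2.2.2

/-- The sequence of iterated extensions of a partial coalgebra. -/
noncomputable def iter (S : PartialCoalgebra κ X) : ℕ → PartialCoalgebra κ X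
  | 0 => S
  | n + 1 => (S.iter n).next

/-- If `κ` is uncountable, every partial coalgebra extends to a coalgebra over `X` with
`κ`-presentable carrier, the colimit of the chain of iterated extensions. -/
lemma exists_coalgebra (S : PartialCoalgebra κ X) (hκ : Cardinal.aleph0 < κ) :
    ∃ (R : Coalgebra F) (r : R ⟶ X) (v : S.B ⟶ R.V), IsCardinalPresentable R.V κ ∧
      v ≫ r.f = S.q ∧ S.u ≫ v ≫ R.str = S.d ≫ F.map v := by
  obtain ⟨R, r, v, h₁, h₂, h₃⟩ := exists_coalgebra_of_chain κ hκ X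
    (fun n => (S.iter n).A) (fun n => (S.iter n).u) (fun n => (S.iter n).d)
    (fun n => (S.iter n).u ≫ (S.iter n).q) (fun n => (S.iter n).hA)
    (fun n => (S.iter n).u_next_d)
    (fun n => congrArg ((S.iter n).u ≫ ·) (S.iter n).next_u_q)
    (fun n => (congrArg (fun k => (S.iter n).d ≫ F.map k) (S.iter n).next_u_q).trans
      ((S.iter n).w.trans (Category.assoc _ _ _).symm))
  exact ⟨R, r, v 1, h₁, (h₂ 1).trans S.next_u_q, h₃ 0⟩

end PartialCoalgebra


variable {κ} in
/-- Every morphism from a `κ`-presentable object to a coalgebra factorizes through a coalgebra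
with `κ`-presentable carrier. -/
lemma exists_coalgebra_factor (hκ : Cardinal.aleph0 < κ) (X : Coalgebra F) {P : C}
    [hP : IsCardinalPresentable P κ] (p : P ⟶ X.V) :
    ∃ (R : Coalgebra F) (r : R ⟶ X) (v : P ⟶ R.V), IsCardinalPresentable R.V κ ∧
      v ≫ r.f = p := by
  have h₀ : IsCardinalPresentable (⊥_ C) κ :=
    have (j : Discrete PEmpty.{1}) :
      IsCardinalPresentable ((Functor.empty.{0} C).obj j) κ := j.as.elim
    isCardinalPresentable_of_isColimit _ (colimit.isColimit (Functor.empty.{0} C)) κ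
      (hasCardinalLT_of_finite _ _ hκ.le)
  obtain ⟨R, r, v, hR, h, -⟩ := PartialCoalgebra.exists_coalgebra (κ := κ) (X := X)
    ⟨⊥_ C, P, initial.to P, p, initial.to _, Subsingleton.elim _ _, h₀, hP⟩ hκ
  exact ⟨R, r, v, hR, h⟩

variable {κ} in
/-- Two factorizations of a morphism from a `κ`-presentable object through coalgebras with
`κ`-presentable carriers are connected by a third one. -/
lemma exists_coalgebra_connect (hκ : Cardinal.aleph0 < κ) {X Q Q' : Coalgebra F} (q : Q ⟶ X)
    (q' : Q' ⟶ X) [hQ : IsCardinalPresentable Q.V κ] [hQ' : IsCardinalPresentable Q'.V κ]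
    {P : C} [hP : IsCardinalPresentable P κ] (a : P ⟶ Q.V) (a' : P ⟶ Q'.V)
    (h : a ≫ q.f = a' ≫ q'.f) :
    ∃ (R : Coalgebra F) (r : R ⟶ X) (g : Q ⟶ R) (g' : Q' ⟶ R), IsCardinalPresentable R.V κ ∧
      g ≫ r = q ∧ g' ≫ r = q' ∧ a ≫ g.f = a' ≫ g'.f := by
  have h₁ : IsCardinalPresentable (Q.V ⨿ Q'.V) κ :=
    have (j : Discrete WalkingPair) :
        IsCardinalPresentable ((pair Q.V Q'.V).obj j) κ := by
      rcases j with ⟨_ | _⟩ <;> assumption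
    isCardinalPresentable_of_isColimit _ (colimit.isColimit (pair Q.V Q'.V)) κ
      (hasCardinalLT_of_finite _ _ hκ.le)
  have h₂ : IsCardinalPresentable (pushout a a') κ :=
    have (j : WalkingSpan) : IsCardinalPresentable ((span a a').obj j) κ := by
      rcases j with _ | _ | _ <;> assumption
    isCardinalPresentable_of_isColimit _ (colimit.isColimit (span a a')) κ
      (hasCardinalLT_of_finite _ _ hκ.le)
  obtain ⟨R, r, v, hR, e₁, e₂⟩ :
      ∃ (R : Coalgebra F) (r : R ⟶ X) (v : pushout a a' ⟶ R.V), IsCardinalPresentable R.V κ ∧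
        v ≫ r.f = pushout.desc q.f q'.f h ∧
        coprod.desc (pushout.inl a a') (pushout.inr a a') ≫ v ≫ R.str =
          coprod.desc (Q.str ≫ F.map (pushout.inl a a')) (Q'.str ≫ F.map (pushout.inr a a')) ≫
            F.map v := PartialCoalgebra.exists_coalgebra (κ := κ) (X := X)
    { A := Q.V ⨿ Q'.V
      B := pushout a a'
      u := coprod.desc (pushout.inl a a') (pushout.inr a a')
      q := pushout.desc q.f q'.f h
      d := coprod.desc (Q.str ≫ F.map (pushout.inl a a')) (Q'.str ≫ F.map (pushout.inr a a'))
      w := by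
        refine coprod.hom_ext ?_ ?_
        · simp only [coprod.inl_desc_assoc, Category.assoc, ← F.map_comp, pushout.inl_desc,
            pushout.inl_desc_assoc, q.h]
        · simp only [coprod.inr_desc_assoc, Category.assoc, ← F.map_comp, pushout.inr_desc,
            pushout.inr_desc_assoc, q'.h]
      hA := h₁
      hB := h₂ } hκ
  have l₁ := coprod.inl ≫= e₂
  have l₂ := coprod.inr ≫= e₂
  simp only [coprod.inl_desc_assoc, coprod.inr_desc_assoc, Category.assoc, ← F.map_comp] at l₁ l₂
  refine ⟨R, r, ⟨pushout.inl a a' ≫ v, by rw [Category.assoc, l₁]⟩,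
    ⟨pushout.inr a a' ≫ v, by rw [Category.assoc, l₂]⟩, hR, ?_, ?_, ?_⟩
  · exact Coalgebra.ext (by simp only [Coalgebra.comp_f, Category.assoc, e₁, pushout.inl_desc])
  · exact Coalgebra.ext (by simp only [Coalgebra.comp_f, Category.assoc, e₁, pushout.inr_desc])
  · simp [pushout.condition_assoc]

variable (F) in
/-- The coalgebras with `κ`-presentable carrier. -/
def presentableCarrier : ObjectProperty (Coalgebra F) :=
  fun Q => IsCardinalPresentable Q.V κ

instance : ObjectProperty.EssentiallySmall.{v} (presentableCarrier κ F) where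
  exists_small_le' := by
    obtain ⟨P, _, hP, hP'⟩ :=
      ObjectProperty.EssentiallySmall.exists_small_le.{v} (isCardinalPresentable C κ)
    let φ : (Σ A : Subtype P, (A.1 ⟶ F.obj A.1)) → Coalgebra F := fun A => ⟨A.1.1, A.2⟩
    refine ⟨ObjectProperty.ofObj φ, inferInstance, fun Q hQ => ?_⟩
    obtain ⟨A, hA, ⟨e⟩⟩ := hP' _ hQ
    exact ⟨_, ⟨(⟨⟨A, hA⟩, e.inv ≫ Q.str ≫ F.map e.hom⟩ : Σ A : Subtype P, (A.1 ⟶ F.obj A.1))⟩,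
      ⟨Coalgebra.isoMk e⟩⟩

variable (F) in
/-- An accessible endofunctor of a locally presentable category has a weakly terminal coalgebra:
the colimit of all coalgebras with `κ`-presentable carrier, for an uncountable `κ` such that the
category is locally `κ`-presentable and the functor preserves `κ`-filtered colimits. -/
lemma exists_weaklyTerminal_coalgebra (hκ : Cardinal.aleph0 < κ) :
    ∃ T : Coalgebra F, ∀ X : Coalgebra F, Nonempty (X ⟶ T) := by
  have := hasColimitsOfShape_of_equivalence (C := Coalgebra F)
    (equivSmallModel.{v} (presentableCarrier κ F).FullSubcategory).symm
  let T : Coalgebra F := colimit (presentableCarrier κ F).ι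
  let t (Q : Coalgebra F) (hQ : IsCardinalPresentable Q.V κ) : Q ⟶ T :=
    colimit.ι (presentableCarrier κ F).ι ⟨Q, hQ⟩
  have ht {Q R : Coalgebra F} (hQ : IsCardinalPresentable Q.V κ)
      (hR : IsCardinalPresentable R.V κ) (g : Q ⟶ R) : g ≫ t R hR = t Q hQ :=
    colimit.w (presentableCarrier κ F).ι
      (j := ⟨R, hR⟩) (j' := ⟨Q, hQ⟩) (ObjectProperty.homMk g)
  refine ⟨T, fun X => ?_⟩
  obtain ⟨J, _, _, ⟨p⟩⟩ :=
    (isCardinalFilteredGenerator_isCardinalPresentable C κ).exists_colimitsOfShape X.V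
  have hp (j : J) : IsCardinalPresentable (p.diag.obj j) κ := p.prop_diag_obj j
  choose Q q a hQ ha using fun j => exists_coalgebra_factor hκ X (p.ι.app j)
  -- The morphism to `T` does not depend on the factorization.
  have key {P : C} [IsCardinalPresentable P κ] {Q Q' : Coalgebra F} (q : Q ⟶ X) (q' : Q' ⟶ X)
      (hQ : IsCardinalPresentable Q.V κ) (hQ' : IsCardinalPresentable Q'.V κ)
      (a : P ⟶ Q.V) (a' : P ⟶ Q'.V) (h : a ≫ q.f = a' ≫ q'.f) :
      a ≫ (t Q hQ).f = a' ≫ (t Q' hQ').f := by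
    obtain ⟨R, r, g, g', hR, -, -, e⟩ := exists_coalgebra_connect hκ q q' a a' h
    rw [← ht hQ hR g, ← ht hQ' hR g', Coalgebra.comp_f, Coalgebra.comp_f, reassoc_of% e]
  let c : Cocone p.diag :=
    { pt := T.V
      ι :=
        { app j := a j ≫ (t (Q j) (hQ j)).f
          naturality j k f := by
            have hw : p.diag.map f ≫ p.ι.app k = p.ι.app j := p.w f
            have := key (q k) (q j) (hQ k) (hQ j) (p.diag.map f ≫ a k) (a j)
              (by rw [Category.assoc, ha, ha]; exact hw)
            simpa using this } }
  let h : X.V ⟶ T.V := p.isColimit.desc c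
  have hh (j : J) : p.ι.app j ≫ h = a j ≫ (t (Q j) (hQ j)).f := p.isColimit.fac c j
  have hqh {R : Coalgebra F} (hR : IsCardinalPresentable R.V κ) (r : R ⟶ X) :
      r.f ≫ h = (t R hR).f := by
    obtain ⟨j, b, hb⟩ := IsCardinalPresentable.exists_hom_of_isColimit κ p.isColimit r.f
    dsimp at hb
    have := key r (q j) hR (hQ j) (𝟙 _) (b ≫ a j) (by rw [Category.assoc, ha, hb]; simp)
    rw [← hb, Category.assoc, hh, ← Category.assoc, ← this, Category.id_comp]
  refine ⟨⟨h, p.isColimit.hom_ext fun j => ?_⟩⟩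
  have e₁ := hh j
  have e₂ := ha j
  dsimp
  rw [reassoc_of% e₁, ← (t (Q j) (hQ j)).h, ← hqh (hQ j) (q j), ← e₂, F.map_comp, Category.assoc,
    (q j).h_assoc]

variable (F) in
/-- An accessible endofunctor of a locally presentable category has a terminal coalgebra. -/
lemma hasTerminal_coalgebra (hκ : Cardinal.aleph0 < κ) : HasTerminal (Coalgebra F) := by
  obtain ⟨T, hT⟩ := exists_weaklyTerminal_coalgebra κ F hκ
  have : HasColimitsOfSize.{v, v} (Coalgebra F) := ⟨fun _ _ => inferInstance⟩
  have : HasWideEqualizers.{v} (Coalgebra F)ᵒᵖ := inferInstance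
  have := hasInitial_of_weakly_initial_and_hasWideEqualizers (C := (Coalgebra F)ᵒᵖ)
    (T := Opposite.op T) fun X => ⟨(hT X.unop).some.op⟩
  exact hasTerminal_of_hasInitial_op

end Accessible
/-! ### Free completely iterative algebras as terminal coalgebras -/

section FreeCiaExistence

lemma nonempty_isColimit_of_existsUnique {C : Type*} [Category* C] {J : Type*} [Category* J]
    {D : J ⥤ C} (c : Cocone D)
    (h : ∀ (Z : C) (a : ∀ j, D.obj j ⟶ Z), (∀ {i j : J} (f : i ⟶ j), D.map f ≫ a j = a i) →
      ∃! m : c.pt ⟶ Z, ∀ j, c.ι.app j ≫ m = a j) : Nonempty (IsColimit c) := by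
  have H (s : Cocone D) := h s.pt s.ι.app s.w
  exact ⟨{  desc s := (H s).choose
            fac s := (H s).choose_spec.1
            uniq s m hm := (H s).choose_spec.2 m hm }⟩

lemma existsUnique_of_isColimit {C : Type*} [Category* C] {J : Type*} [Category* J]
    {D : J ⥤ C} {c : Cocone D} (hc : IsColimit c) {Z : C} (a : ∀ j, D.obj j ⟶ Z)
    (ha : ∀ {i j : J} (f : i ⟶ j), D.map f ≫ a j = a i) :
    ∃! m : c.pt ⟶ Z, ∀ j, c.ι.app j ≫ m = a j := by
  let s : Cocone D := ⟨Z, ⟨a, fun i j f => (ha f).trans (Category.comp_id _).symm⟩⟩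
  exact ⟨hc.desc s, hc.fac s, fun m hm => hc.uniq s m hm⟩

variable {C : Type u} [Category.{v} C] [HasBinaryCoproducts C]

/-- The endofunctor `H(-) + X`. -/
noncomputable def addConst (H : C ⥤ C) (X : C) : C ⥤ C where
  obj Y := H.obj Y ⨿ X
  map f := coprod.map (H.map f) (𝟙 X)

namespace addConst

variable (H : C ⥤ C) (X : C)

/-- The first injection `HY ⟶ HY + X`. -/
noncomputable def inl (Y : C) : H.obj Y ⟶ (addConst H X).obj Y :=
  (coprod.inl : H.obj Y ⟶ H.obj Y ⨿ X)

/-- The second injection `X ⟶ HY + X`. -/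
noncomputable def inr (Y : C) : X ⟶ (addConst H X).obj Y :=
  (coprod.inr : X ⟶ H.obj Y ⨿ X)

variable {H X}

/-- The morphism out of `HY + X` with given components. -/
noncomputable def desc {Y Z : C} (a : H.obj Y ⟶ Z) (b : X ⟶ Z) : (addConst H X).obj Y ⟶ Z :=
  coprod.desc a b

lemma inl_desc {Y Z : C} (a : H.obj Y ⟶ Z) (b : X ⟶ Z) : inl H X Y ≫ desc a b = a :=
  coprod.inl_desc a b

lemma inr_desc {Y Z : C} (a : H.obj Y ⟶ Z) (b : X ⟶ Z) : inr H X Y ≫ desc a b = b :=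
  coprod.inr_desc a b

lemma inl_desc_assoc {Y Z W : C} (a : H.obj Y ⟶ Z) (b : X ⟶ Z) (h : Z ⟶ W) :
    inl H X Y ≫ desc a b ≫ h = a ≫ h := by
  rw [← Category.assoc, inl_desc]

lemma inr_desc_assoc {Y Z W : C} (a : H.obj Y ⟶ Z) (b : X ⟶ Z) (h : Z ⟶ W) :
    inr H X Y ≫ desc a b ≫ h = b ≫ h := by
  rw [← Category.assoc, inr_desc]

lemma hom_ext {Y Z : C} {f g : (addConst H X).obj Y ⟶ Z} (h₁ : inl H X Y ≫ f = inl H X Y ≫ g)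
    (h₂ : inr H X Y ≫ f = inr H X Y ≫ g) : f = g :=
  coprod.hom_ext h₁ h₂

lemma inl_map {Y Y' : C} (f : Y ⟶ Y') :
    inl H X Y ≫ (addConst H X).map f = H.map f ≫ inl H X Y' :=
  coprod.inl_map (H.map f) (𝟙 X)

lemma inr_map {Y Y' : C} (f : Y ⟶ Y') : inr H X Y ≫ (addConst H X).map f = inr H X Y' :=
  (coprod.inr_map (H.map f) (𝟙 X)).trans (Category.id_comp _)

lemma inl_map_assoc {Y Y' Z : C} (f : Y ⟶ Y') (h : (addConst H X).obj Y' ⟶ Z) :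
    inl H X Y ≫ (addConst H X).map f ≫ h = H.map f ≫ inl H X Y' ≫ h := by
  rw [← Category.assoc, inl_map, Category.assoc]

lemma inr_map_assoc {Y Y' Z : C} (f : Y ⟶ Y') (h : (addConst H X).obj Y' ⟶ Z) :
    inr H X Y ≫ (addConst H X).map f ≫ h = inr H X Y' ≫ h := by
  rw [← Category.assoc, inr_map]

variable (H X)

lemma preservesColimitsOfShape {J : Type*} [Category* J]
    [IsFiltered J] [PreservesColimitsOfShape J H] :
    PreservesColimitsOfShape J (addConst H X) where
  preservesColimit {K} := ⟨fun {c} hc => nonempty_isColimit_of_existsUnique _ <| by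
    have hH := isColimitOfPreserves H hc
    let i (j : J) : K.obj j ⟶ c.pt := c.ι.app j
    suffices ∀ (Z : C) (a : ∀ j, (addConst H X).obj (K.obj j) ⟶ Z),
        (∀ {i j : J} (f : i ⟶ j), (addConst H X).map (K.map f) ≫ a j = a i) →
        ∃! m : (addConst H X).obj c.pt ⟶ Z, ∀ j, (addConst H X).map (i j) ≫ m = a j from this
    intro Z a ha
    have hl : ∃! m : H.obj c.pt ⟶ Z, ∀ j, H.map (i j) ≫ m = inl H X (K.obj j) ≫ a j :=
      existsUnique_of_isColimit hH (fun j => inl H X (K.obj j) ≫ a j) fun {i j} f => by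
        change H.map (K.map f) ≫ inl H X (K.obj j) ≫ a j = inl H X (K.obj i) ≫ a i
        rw [← ha f, inl_map_assoc]
    -- The second injections form a cocone on a constant diagram, over a connected category.
    have hr {i j : J} (f : i ⟶ j) :
        inr H X (K.obj i) ≫ a i = inr H X (K.obj j) ≫ a j := by
      rw [← ha f, inr_map_assoc]
    let j₀ : J := Classical.choice IsFiltered.nonempty
    have hr' (j : J) : inr H X (K.obj j₀) ≫ a j₀ = inr H X (K.obj j) ≫ a j :=
      (hr (IsFiltered.leftToMax j₀ j)).trans (hr (IsFiltered.rightToMax j₀ j)).symm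
    obtain ⟨m, hm, hm'⟩ := hl
    refine ⟨desc m (inr H X (K.obj j₀) ≫ a j₀), fun j => hom_ext ?_ ?_, fun n hn => hom_ext ?_ ?_⟩
    · rw [inl_map_assoc, inl_desc, hm]
    · rw [inr_map_assoc, inr_desc, hr']
    · rw [inl_desc]
      exact hm' _ fun j => by rw [← inl_map_assoc, hn]
    · rw [inr_desc, ← hn j₀, inr_map_assoc]⟩

lemma isCardinalAccessible (κ : Cardinal.{v}) [Fact κ.IsRegular] [PreservesFilteredColimits H] :
    (addConst H X).IsCardinalAccessible κ where
  preservesColimitOfShape J _ _ := by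
    have := isFiltered_of_isCardinalFiltered J κ
    exact preservesColimitsOfShape H X

end addConst

variable {H : C ⥤ C}

lemma isSolution_iff (A : Algebra H) {X : C} (e : X ⟶ H.obj X ⨿ A.a) (s : X ⟶ A.a) :
    IsSolution A e s ↔ e ≫ coprod.desc (H.map s ≫ A.str) (𝟙 A.a) = s := by
  rw [IsSolution, coprod.map_desc, Category.comp_id, eq_comm]

variable {X : C}

/-- The assertion that the algebra structure of `A` and `η` are the components of the inverse of
a terminal coalgebra structure `t : A ⟶ HA + X`. -/
structure IsTerminalCoalgebraAlg (A : Algebra H) (η : X ⟶ A.a)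
    (t : A.a ⟶ (addConst H X).obj A.a) : Prop where
  str_t : A.str ≫ t = addConst.inl H X A.a
  unit_t : η ≫ t = addConst.inr H X A.a
  t_desc : t ≫ addConst.desc A.str η = 𝟙 A.a
  existsUnique (W : C) (r : W ⟶ (addConst H X).obj W) :
    ∃! f : W ⟶ A.a, r ≫ (addConst H X).map f = f ≫ t

lemma exists_isTerminalCoalgebraAlg [HasTerminal (Coalgebra (addConst H X))] :
    ∃ (A : Algebra H) (η : X ⟶ A.a) (t : A.a ⟶ (addConst H X).obj A.a),
      IsTerminalCoalgebraAlg A η t := by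
  let T : Coalgebra (addConst H X) := ⊤_ _
  have hT : IsTerminal T := terminalIsTerminal
  let i : (addConst H X).obj T.V ⟶ T.V := Coalgebra.Terminal.strInv hT
  have hi : i ≫ T.str = 𝟙 _ := Coalgebra.Terminal.left_inv hT
  have hi' : T.str ≫ i = 𝟙 _ := Coalgebra.Terminal.right_inv hT
  refine ⟨⟨T.V, addConst.inl H X T.V ≫ i⟩, addConst.inr H X T.V ≫ i, T.str, ?_, ?_, ?_,
    fun W r => ?_⟩
  · dsimp only
    rw [Category.assoc, hi, Category.comp_id]
  · rw [Category.assoc, hi, Category.comp_id]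
  · dsimp only
    rw [← hi']
    congr 1
    exact addConst.hom_ext (addConst.inl_desc _ _) (addConst.inr_desc _ _)
  · let R : Coalgebra (addConst H X) := ⟨W, r⟩
    exact ⟨(hT.from R).f, (hT.from R).h, fun f hf =>
      congrArg (fun k => k.f) (hT.hom_ext (⟨f, hf⟩ : R ⟶ T) (hT.from R))⟩

namespace IsTerminalCoalgebraAlg

variable {A : Algebra H} {η : X ⟶ A.a} {t : A.a ⟶ (addConst H X).obj A.a}
  (hA : IsTerminalCoalgebraAlg A η t)
include hA

lemma comp_t_cancel {Z : C} {f g : Z ⟶ A.a} (h : f ≫ t = g ≫ t) : f = g := by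
  rw [← Category.comp_id f, ← Category.comp_id g, ← hA.t_desc, reassoc_of% h]

omit hA in
/-- Given a flat equation morphism `e : Z ⟶ HZ + A`, the coalgebra structure on `Z + A` that
is `e` followed by the structure of `A` on the second component. -/
noncomputable def equationStr (t : A.a ⟶ (addConst H X).obj A.a) {Z : C}
    (e : Z ⟶ H.obj Z ⨿ A.a) : Z ⨿ A.a ⟶ (addConst H X).obj (Z ⨿ A.a) :=
  coprod.desc
    (e ≫ coprod.desc (H.map coprod.inl ≫ addConst.inl H X _)
      (t ≫ (addConst H X).map coprod.inr))
    (t ≫ (addConst H X).map coprod.inr)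

/-- Solutions of `e : Z ⟶ HZ + A` are the coalgebra homomorphisms `Z + A ⟶ A` that are the
identity on the second component. -/
lemma isSolution_iff_coalgebraHom {Z : C} (e : Z ⟶ H.obj Z ⨿ A.a) (s : Z ⟶ A.a) :
    IsSolution A e s ↔
      equationStr t e ≫ (addConst H X).map (coprod.desc s (𝟙 A.a)) =
        coprod.desc s (𝟙 A.a) ≫ t := by
  have hr : coprod.inr ≫ equationStr t e ≫ (addConst H X).map (coprod.desc s (𝟙 A.a)) = t := by
    rw [equationStr, coprod.inr_desc_assoc, Category.assoc, ← Functor.map_comp, coprod.inr_desc,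
      CategoryTheory.Functor.map_id, Category.comp_id]
  have hl : coprod.inl ≫ equationStr t e ≫ (addConst H X).map (coprod.desc s (𝟙 A.a)) =
        (e ≫ coprod.desc (H.map s ≫ A.str) (𝟙 A.a)) ≫ t := by
    rw [equationStr, coprod.inl_desc_assoc, Category.assoc, Category.assoc]
    congr 1
    refine coprod.hom_ext ?_ ?_
    · rw [coprod.inl_desc_assoc, coprod.inl_desc_assoc, Category.assoc, addConst.inl_map,
        ← H.map_comp_assoc, coprod.inl_desc, Category.assoc, hA.str_t]
    · rw [coprod.inr_desc_assoc, coprod.inr_desc_assoc, Category.assoc, ← Functor.map_comp,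
        coprod.inr_desc, CategoryTheory.Functor.map_id, Category.comp_id, Category.id_comp]
  rw [isSolution_iff]
  constructor
  · intro h
    refine coprod.hom_ext ?_ ?_
    · rw [coprod.inl_desc_assoc, hl, h]
    · rw [coprod.inr_desc_assoc, Category.id_comp, hr]
  · intro h
    refine hA.comp_t_cancel ?_
    rw [← hl, h, coprod.inl_desc_assoc]

/-- The terminal coalgebra for `H(-) + X` is a completely iterative algebra. -/
lemma isCia : IsCia A := by
  intro Z e
  obtain ⟨f, hf, hf'⟩ := hA.existsUnique _ (equationStr t e)
  have hinr : coprod.inr ≫ f = 𝟙 A.a := by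
    refine (hA.existsUnique _ t).unique ?_ (by
      rw [CategoryTheory.Functor.map_id, Category.comp_id, Category.id_comp])
    rw [Category.assoc, ← hf, equationStr, coprod.inr_desc_assoc, Functor.map_comp,
      Category.assoc]
  have hdesc : coprod.desc (coprod.inl ≫ f) (𝟙 A.a) = f :=
    coprod.hom_ext (coprod.inl_desc _ _) ((coprod.inr_desc _ _).trans hinr.symm)
  refine ⟨coprod.inl ≫ f, ?_, fun s hs => ?_⟩
  · refine (hA.isSolution_iff_coalgebraHom e _).2 ?_
    rw [hdesc, hf]
  · rw [← hf' _ ((hA.isSolution_iff_coalgebraHom e s).1 hs), coprod.inl_desc]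

/-- Homomorphisms out of `A` extending `f : X ⟶ B` are the solutions of the flat equation
morphism `A ⟶ HA + X ⟶ HA + B`. -/
lemma isSolution_iff_hom {B : Algebra H} (f : X ⟶ B.a) (h : A.a ⟶ B.a) :
    IsSolution B (t ≫ addConst.desc coprod.inl (f ≫ coprod.inr)) h ↔
      H.map h ≫ B.str = A.str ≫ h ∧ η ≫ h = f := by
  have key : addConst.desc coprod.inl (f ≫ coprod.inr) ≫ coprod.desc (H.map h ≫ B.str) (𝟙 B.a) =
      addConst.desc (H.map h ≫ B.str) f := by
    refine addConst.hom_ext ?_ ?_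
    · rw [addConst.inl_desc_assoc, coprod.inl_desc, addConst.inl_desc]
    · rw [addConst.inr_desc_assoc, Category.assoc, coprod.inr_desc, addConst.inr_desc,
        Category.comp_id]
  rw [isSolution_iff, Category.assoc, key]
  constructor
  · intro e
    have e₁ := A.str ≫= e
    have e₂ := η ≫= e
    rw [reassoc_of% hA.str_t, addConst.inl_desc] at e₁
    rw [reassoc_of% hA.unit_t, addConst.inr_desc] at e₂
    exact ⟨e₁, e₂.symm⟩
  · rintro ⟨e₁, e₂⟩
    have : addConst.desc (H.map h ≫ B.str) f = addConst.desc A.str η ≫ h := by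
      refine addConst.hom_ext ?_ ?_
      · rw [addConst.inl_desc, addConst.inl_desc_assoc, e₁]
      · rw [addConst.inr_desc, addConst.inr_desc_assoc, e₂]
    rw [this, reassoc_of% hA.t_desc]

/-- The terminal coalgebra for `H(-) + X` is a free completely iterative algebra on `X`. -/
noncomputable def freeCia : FreeCia H X where
  alg := A
  unit := η
  isCia := hA.isCia
  universal B hB f := by
    obtain ⟨h, hh, huniq⟩ := hB A.a (t ≫ addConst.desc coprod.inl (f ≫ coprod.inr))
    obtain ⟨h₁, h₂⟩ := (hA.isSolution_iff_hom f h).1 hh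
    exact ⟨⟨h, h₁⟩, h₂, fun g hg =>
      Algebra.ext (huniq g.f ((hA.isSolution_iff_hom f g.f).2 ⟨g.h, hg⟩))⟩

lemma isIso_desc : IsIso (coprod.desc A.str η) := by
  have e : addConst.desc A.str η ≫ t = 𝟙 _ := by
    refine addConst.hom_ext ?_ ?_
    · rw [addConst.inl_desc_assoc, hA.str_t, Category.comp_id]
    · rw [addConst.inr_desc_assoc, hA.unit_t, Category.comp_id]
  exact ⟨t, e, hA.t_desc⟩

end IsTerminalCoalgebraAlg

lemma nonempty_freeCia [HasTerminal (Coalgebra (addConst H X))] : Nonempty (FreeCia H X) := by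
  obtain ⟨_, _, _, hA⟩ := exists_isTerminalCoalgebraAlg (H := H) (X := X)
  exact ⟨hA.freeCia⟩

/-- The algebra structure and the unit of a free completely iterative algebra on `X` exhibit it
as the coproduct `HTX + X`. -/
lemma isIso_desc_of_freeCia [HasTerminal (Coalgebra (addConst H X))] (T : FreeCia H X) :
    IsIso (coprod.desc T.alg.str T.unit) := by
  obtain ⟨A, η, t, hA⟩ := exists_isTerminalCoalgebraAlg (H := H) (X := X)
  let T₀ : FreeCia H X := hA.freeCia
  have h₀ : IsIso (coprod.desc T₀.alg.str T₀.unit) := hA.isIso_desc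
  let f := T.lift T₀.isCia T₀.unit
  let g := T₀.lift T.isCia T.unit
  have hf : T.unit ≫ f.f = T₀.unit := T.unit_lift _ _
  have hg : T₀.unit ≫ g.f = T.unit := T₀.unit_lift _ _
  have hfg : f ≫ g = 𝟙 _ := T.hom_ext T.isCia (by
    rw [Algebra.comp_f, reassoc_of% hf, hg]; exact (Category.comp_id _).symm)
  have hgf : g ≫ f = 𝟙 _ := T₀.hom_ext T₀.isCia (by
    rw [Algebra.comp_f, reassoc_of% hg, hf]; exact (Category.comp_id _).symm)
  have hi : IsIso f.f :=
    ⟨g.f, congrArg (fun k => k.f) hfg, congrArg (fun k => k.f) hgf⟩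
  have e : coprod.desc T.alg.str T.unit ≫ f.f =
      coprod.map (H.map f.f) (𝟙 X) ≫ coprod.desc T₀.alg.str T₀.unit := by
    refine coprod.hom_ext ?_ ?_
    · rw [coprod.inl_desc_assoc, coprod.inl_map_assoc, coprod.inl_desc, f.h]
    · rw [coprod.inr_desc_assoc, coprod.inr_map_assoc, coprod.inr_desc, hf, Category.id_comp]
  have : IsIso (coprod.desc T.alg.str T.unit ≫ f.f) := by
    rw [e]
    infer_instance
  exact IsIso.of_isIso_comp_right _ f.f

end FreeCiaExistence

section LocallyFinitelyPresentable

attribute [local instance] Cardinal.fact_isRegular_aleph0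

/-- The existence of terminal coalgebras for `H(-) + X` in a locally finitely presentable
category, where `H` is finitary. -/
lemma hasTerminal_coalgebra_addConst {C : Type u} [Category.{v} C]
    [hC : IsLocallyFinitelyPresentable.{v} C] [HasBinaryCoproducts C]
    (H : C ⥤ C) [PreservesFilteredColimits H] (X : C) :
    HasTerminal (Coalgebra (addConst H X)) := by
  let κ : Cardinal.{v} := Cardinal.aleph 1
  have : Fact κ.IsRegular := ⟨Cardinal.isRegular_aleph_one⟩
  have hκ : Cardinal.aleph0 < κ := Cardinal.aleph0_lt_aleph_one
  have : IsCardinalLocallyPresentable C κ :=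
    IsCardinalLocallyPresentable.of_le (κ := Cardinal.aleph0) C hκ.le
  have := addConst.isCardinalAccessible H X κ
  exact hasTerminal_coalgebra κ (addConst H X) hκ

end LocallyFinitelyPresentable

/-! ### Homomorphisms in the first variable -/

section TensorHom

lemma comp_tensorHom {C : Type*} [Category* C] [MonoidalCategory C] {A B D E F : C}
    (f : A ⟶ B) (g : B ⟶ D) (h : E ⟶ F) : (f ≫ g) ⊗ₘ h = (f ⊗ₘ h) ≫ (g ▷ F) := by
  rw [← tensorHom_id, MonoidalCategory.tensorHom_comp_tensorHom, Category.comp_id]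

variable {C : Type u} [Category.{v} C] [MonoidalCategory C] {H : C ⥤ C} (s : PointStrength H)

/-- A morphism `f : A ⊗ Y ⟶ B` between algebras is a homomorphism in its first variable, for the
point-strength `s` and a pointing `a` of `A`, if `f ∘ (A.str ⊗ Y) = B.str ∘ H f ∘ s`. -/
def IsTensorHom {A B : Algebra H} (a : 𝟙_ C ⟶ A.a) (Y : Under (𝟙_ C))
    (f : A.a ⊗ Y.right ⟶ B.a) : Prop :=
  (A.str ▷ Y.right) ≫ f = s.app (Under.mk a) Y ≫ H.map f ≫ B.str

namespace PointStrength

lemma naturality_left {X X' : C} {x : 𝟙_ C ⟶ X} {x' : 𝟙_ C ⟶ X'} (Y : Under (𝟙_ C)) (f : X ⟶ X')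
    (w : x ≫ f = x') :
    (H.map f ▷ Y.right) ≫ s.app (Under.mk x') Y =
      s.app (Under.mk x) Y ≫ H.map (f ▷ Y.right) := by
  have h := s.naturality (Under.homMk (U := Under.mk x) (V := Under.mk x') f w) (𝟙 Y)
  simpa using h

lemma naturality_right (X : Under (𝟙_ C)) {Y Y' : Under (𝟙_ C)} (g : Y ⟶ Y') :
    (H.obj X.right ◁ g.right) ≫ s.app X Y' = s.app X Y ≫ H.map (X.right ◁ g.right) := by
  have h := s.naturality (𝟙 X) g
  simpa using h

end PointStrength

namespace IsTensorHom

variable {s} {A B B' : Algebra H} {a : 𝟙_ C ⟶ A.a} {Y Z : Under (𝟙_ C)}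

lemma comp {f : A.a ⊗ Y.right ⟶ B.a} (hf : IsTensorHom s a Y f) (h : B ⟶ B') :
    IsTensorHom s a Y (f ≫ h.f) := by
  unfold IsTensorHom at *
  rw [reassoc_of% hf, H.map_comp, Category.assoc, ← h.h]

lemma whiskerLeft_comp {f : A.a ⊗ Y.right ⟶ B.a} (hf : IsTensorHom s a Y f) (g : Z ⟶ Y) :
    IsTensorHom s a Z ((A.a ◁ g.right) ≫ f) := by
  have := s.naturality_right (Under.mk a) g
  dsimp at this
  unfold IsTensorHom at *
  rw [← whisker_exchange_assoc, hf, reassoc_of% this, H.map_comp, Category.assoc]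

lemma whiskerRight_comp {A' : Algebra H} {a' : 𝟙_ C ⟶ A'.a} {f : A'.a ⊗ Y.right ⟶ B.a}
    (hf : IsTensorHom s a' Y f) (h : A ⟶ A') (w : a ≫ h.f = a') :
    IsTensorHom s a Y ((h.f ▷ Y.right) ≫ f) := by
  have := s.naturality_left Y h.f w
  unfold IsTensorHom at *
  rw [← comp_whiskerRight_assoc, ← h.h, comp_whiskerRight_assoc, hf, reassoc_of% this,
    H.map_comp, Category.assoc]

variable (s a) in
lemma rightUnitor : IsTensorHom s a (unitPt C) (ρ_ A.a).hom := by
  have := s.unit (Under.mk a)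
  dsimp at this
  dsimp [IsTensorHom]
  rw [rightUnitor_naturality, reassoc_of% this]

/-- Homomorphisms in the first variable compose: this is where the associativity axiom of the
point-strength enters. -/
lemma assoc {b : 𝟙_ C ⟶ B.a} {f : A.a ⊗ Y.right ⟶ B.a} (hf : IsTensorHom s a Y f)
    (w : (λ_ (𝟙_ C)).inv ≫ (a ⊗ₘ Y.hom) ≫ f = b)
    {k : B.a ⊗ Z.right ⟶ B'.a} (hk : IsTensorHom s b Z k) :
    IsTensorHom s a (tensorPt Y Z)
      ((α_ A.a Y.right Z.right).inv ≫ (f ▷ Z.right) ≫ k) := by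
  have h₁ := s.naturality_left (x := (tensorPt (Under.mk a) Y).hom) Z f
    (by simpa using w)
  have h₂ := s.assoc (Under.mk a) Y Z
  dsimp at h₁ h₂
  dsimp [IsTensorHom] at *
  rw [associator_inv_naturality_left_assoc, ← comp_whiskerRight_assoc, hf,
    comp_whiskerRight_assoc, comp_whiskerRight_assoc, hk, reassoc_of% h₁]
  rw [← Iso.inv_comp_eq] at h₂
  have e : H.map (α_ A.a Y.right Z.right).hom ≫
      H.map ((α_ A.a Y.right Z.right).inv ≫ f ▷ Z.right ≫ k) = H.map (f ▷ Z.right ≫ k) := by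
    rw [← H.map_comp, Iso.hom_inv_id_assoc]
  rw [← h₂]
  simp only [Category.assoc]
  rw [reassoc_of% e, H.map_comp, Category.assoc]
  rfl

end IsTensorHom

end TensorHom

/-! ### The induced point-strength -/

section InducedStrength

variable {C : Type u} [Category.{v} C] [MonoidalCategory C] [HasBinaryCoproducts C]
  [∀ W : C, PreservesFiniteCoproducts (tensorRight W)]
  {H : C ⥤ C} {s : PointStrength H}

lemma isIso_desc_whiskerRight {X Y Z : C} (f : X ⟶ Z) (g : Y ⟶ Z) [IsIso (coprod.desc f g)]
    (W : C) : IsIso (coprod.desc (f ▷ W) (g ▷ W)) := by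
  have h : coprod.desc ((tensorRight W).map f) ((tensorRight W).map g) =
      coprodComparison (tensorRight W) X Y ≫ (tensorRight W).map (coprod.desc f g) := by
    refine coprod.hom_ext ?_ ?_
    · rw [coprodComparison_inl_assoc, ← Functor.map_comp, coprod.inl_desc, coprod.inl_desc]
    · rw [coprodComparison_inr_assoc, ← Functor.map_comp, coprod.inr_desc, coprod.inr_desc]
  change IsIso (coprod.desc ((tensorRight W).map f) ((tensorRight W).map g))
  rw [h]
  infer_instance

/-- The key universal property: homomorphisms `TX ⊗ Y ⟶ B` in the first variable, into a
completely iterative algebra `B`, correspond to morphisms `X ⊗ Y ⟶ B`. Indeed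
`TX ⊗ Y = HTX ⊗ Y + X ⊗ Y`, and the homomorphisms are the solutions of a flat equation
morphism `TX ⊗ Y ⟶ H(TX ⊗ Y) + B`. -/
lemma existsUnique_isTensorHom {X : C} (x : 𝟙_ C ⟶ X) (T : FreeCia H X)
    [IsIso (coprod.desc T.alg.str T.unit)] (Y : Under (𝟙_ C)) {B : Algebra H} (hB : IsCia B)
    (g : X ⊗ Y.right ⟶ B.a) :
    ∃! f : T.alg.a ⊗ Y.right ⟶ B.a,
      IsTensorHom s (x ≫ T.unit) Y f ∧ (T.unit ▷ Y.right) ≫ f = g := by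
  have := isIso_desc_whiskerRight T.alg.str T.unit Y.right
  let k := inv (coprod.desc (T.alg.str ▷ Y.right) (T.unit ▷ Y.right))
  let σ : H.obj T.alg.a ⊗ Y.right ⟶ H.obj (T.alg.a ⊗ Y.right) := s.app (Under.mk (x ≫ T.unit)) Y
  refine (existsUnique_congr fun f => ?_).1 (hB _ (k ≫ coprod.map σ g))
  rw [isSolution_iff, Category.assoc, IsIso.inv_comp_eq]
  constructor
  · intro h
    have h₁ := coprod.inl ≫= h
    have h₂ := coprod.inr ≫= h
    rw [coprod.inl_map_assoc, coprod.inl_desc, coprod.inl_desc_assoc] at h₁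
    rw [coprod.inr_map_assoc, coprod.inr_desc, coprod.inr_desc_assoc, Category.comp_id] at h₂
    exact ⟨h₁.symm, h₂.symm⟩
  · rintro ⟨h₁, h₂⟩
    refine coprod.hom_ext ?_ ?_
    · rw [coprod.inl_map_assoc, coprod.inl_desc, coprod.inl_desc_assoc]
      exact h₁.symm
    · rw [coprod.inr_map_assoc, coprod.inr_desc, coprod.inr_desc_assoc, Category.comp_id, h₂]

lemma IsTensorHom.ext {X : C} {x : 𝟙_ C ⟶ X} {T : FreeCia H X}
    [IsIso (coprod.desc T.alg.str T.unit)] {Y : Under (𝟙_ C)} {B : Algebra H} (hB : IsCia B)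
    {f f' : T.alg.a ⊗ Y.right ⟶ B.a} (hf : IsTensorHom s (x ≫ T.unit) Y f)
    (hf' : IsTensorHom s (x ≫ T.unit) Y f')
    (h : (T.unit ▷ Y.right) ≫ f = (T.unit ▷ Y.right) ≫ f') : f = f' :=
  (existsUnique_isTensorHom x T Y hB ((T.unit ▷ Y.right) ≫ f')).unique ⟨hf, h⟩ ⟨hf', rfl⟩

variable (s) (T : ∀ X : C, FreeCia H X) [∀ X, IsIso (coprod.desc (T X).alg.str (T X).unit)]

/-- The component `TX ⊗ Y ⟶ T(X ⊗ Y)` of the induced point-strength: the homomorphism in the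
first variable that extends the unit of `T(X ⊗ Y)`. -/
noncomputable def inducedApp (X Y : Under (𝟙_ C)) :
    (T X.right).alg.a ⊗ Y.right ⟶ (T (X.right ⊗ Y.right)).alg.a :=
  (existsUnique_isTensorHom (s := s) X.hom (T X.right) Y (T (X.right ⊗ Y.right)).isCia
    (T (X.right ⊗ Y.right)).unit).choose

lemma isTensorHom_inducedApp (X Y : Under (𝟙_ C)) :
    IsTensorHom s (X.hom ≫ (T X.right).unit) Y (inducedApp s T X Y) :=
  (existsUnique_isTensorHom (s := s) X.hom (T X.right) Y (T (X.right ⊗ Y.right)).isCia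
    (T (X.right ⊗ Y.right)).unit).choose_spec.1.1

lemma unit_inducedApp (X Y : Under (𝟙_ C)) :
    ((T X.right).unit ▷ Y.right) ≫ inducedApp s T X Y = (T (X.right ⊗ Y.right)).unit :=
  (existsUnique_isTensorHom (s := s) X.hom (T X.right) Y (T (X.right ⊗ Y.right)).isCia
    (T (X.right ⊗ Y.right)).unit).choose_spec.1.2

lemma unit_inducedApp_assoc (X Y : Under (𝟙_ C)) {Z : C}
    (h : (T (X.right ⊗ Y.right)).alg.a ⟶ Z) :
    ((T X.right).unit ▷ Y.right) ≫ inducedApp s T X Y ≫ h =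
      (T (X.right ⊗ Y.right)).unit ≫ h := by
  rw [← Category.assoc, unit_inducedApp]

/-- The algebra homomorphism `Tf` for the monad of free completely iterative algebras. -/
noncomputable abbrev mapHom {X Y : C} (f : X ⟶ Y) : (T X).alg ⟶ (T Y).alg :=
  (T X).lift (T Y).isCia (f ≫ (T Y).unit)

omit [MonoidalCategory C] [∀ W : C, PreservesFiniteCoproducts (tensorRight W)]
  [∀ X, IsIso (coprod.desc (T X).alg.str (T X).unit)] in
lemma unit_mapHom {X Y : C} (f : X ⟶ Y) : (T X).unit ≫ (mapHom T f).f = f ≫ (T Y).unit :=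
  (T X).unit_lift _ _

omit [MonoidalCategory C] [∀ W : C, PreservesFiniteCoproducts (tensorRight W)]
  [∀ X, IsIso (coprod.desc (T X).alg.str (T X).unit)] in
lemma unit_mapHom_assoc {X Y Z : C} (f : X ⟶ Y) (h : (T Y).alg.a ⟶ Z) :
    (T X).unit ≫ (mapHom T f).f ≫ h = f ≫ (T Y).unit ≫ h := by
  rw [← Category.assoc, unit_mapHom, Category.assoc]

lemma inducedApp_naturality {X X' Y Y' : Under (𝟙_ C)} (f : X ⟶ X') (g : Y ⟶ Y') :
    ((mapHom T f.right).f ⊗ₘ g.right) ≫ inducedApp s T X' Y' =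
      inducedApp s T X Y ≫ (mapHom T (f.right ⊗ₘ g.right)).f := by
  rw [MonoidalCategory.tensorHom_def, Category.assoc]
  refine IsTensorHom.ext (x := X.hom) (T _).isCia ?_ ((isTensorHom_inducedApp s T X Y).comp _) ?_
  · refine ((isTensorHom_inducedApp s T X' Y').whiskerLeft_comp g).whiskerRight_comp
      (mapHom T f.right) ?_
    rw [Category.assoc, unit_mapHom, ← Category.assoc]
    exact congrArg (· ≫ (T X'.right).unit) (Under.w f)
  · rw [← comp_whiskerRight_assoc, unit_mapHom, unit_inducedApp_assoc, unit_mapHom,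
      comp_whiskerRight_assoc, ← whisker_exchange_assoc, unit_inducedApp,
      MonoidalCategory.tensorHom_def, Category.assoc]

lemma inducedApp_unit (X : Under (𝟙_ C)) :
    inducedApp s T X (unitPt C) ≫ (mapHom T (ρ_ X.right).hom).f = (ρ_ (T X.right).alg.a).hom := by
  refine IsTensorHom.ext (x := X.hom) (T _).isCia ((isTensorHom_inducedApp s T X _).comp _)
    (IsTensorHom.rightUnitor s _) ?_
  rw [unit_inducedApp_assoc, unit_mapHom]
  exact (rightUnitor_naturality _).symm

lemma pt_inducedApp (X Y : Under (𝟙_ C)) :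
    (λ_ (𝟙_ C)).inv ≫ ((X.hom ≫ (T X.right).unit) ⊗ₘ Y.hom) ≫ inducedApp s T X Y =
      (tensorPt X Y).hom ≫ (T (X.right ⊗ Y.right)).unit := by
  have h : (X.hom ≫ (T X.right).unit) ⊗ₘ Y.hom =
      (X.hom ⊗ₘ Y.hom) ≫ ((T X.right).unit ▷ Y.right) :=
    comp_tensorHom X.hom (T X.right).unit Y.hom
  rw [h, Category.assoc, unit_inducedApp]
  exact (Category.assoc _ _ _).symm

lemma inducedApp_assoc (X Y Z : Under (𝟙_ C)) :
    (inducedApp s T X Y ▷ Z.right) ≫ inducedApp s T (tensorPt X Y) Z ≫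
        (mapHom T (α_ X.right Y.right Z.right).hom).f =
      (α_ (T X.right).alg.a Y.right Z.right).hom ≫ inducedApp s T X (tensorPt Y Z) := by
  rw [← Iso.inv_comp_eq]
  refine IsTensorHom.ext (x := X.hom) (Y := tensorPt Y Z) (T _).isCia ?_
    (isTensorHom_inducedApp s T X _) ?_
  · exact (isTensorHom_inducedApp s T X Y).assoc (pt_inducedApp s T X Y)
      ((isTensorHom_inducedApp s T (tensorPt X Y) Z).comp _)
  · have h₁ := unit_inducedApp s T X (tensorPt Y Z)
    have h₂ := unit_inducedApp s T (tensorPt X Y) Z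
    dsimp at h₁ h₂ ⊢
    rw [h₁, associator_inv_naturality_left_assoc, ← comp_whiskerRight_assoc, unit_inducedApp,
      reassoc_of% h₂, unit_mapHom, Iso.inv_hom_id_assoc]

/-- The point-strength of the monad of free completely iterative algebras induced by the
point-strength of `H`. -/
noncomputable def inducedStrength : PointStrength (FreeCia.monad T).toFunctor where
  app := inducedApp s T
  naturality f g := inducedApp_naturality s T f g
  unit X := inducedApp_unit s T X
  assoc X Y Z := inducedApp_assoc s T X Y Z

lemma isInducedStrength_inducedStrength :
    IsInducedStrength s T (inducedStrength s T).app := fun X Y =>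
  ⟨isTensorHom_inducedApp s T X Y, unit_inducedApp s T X Y⟩

lemma eq_inducedStrength {t : ∀ X Y : Under (𝟙_ C), (FreeCia.monad T).obj X.right ⊗ Y.right ⟶
      (FreeCia.monad T).obj (X.right ⊗ Y.right)} (ht : IsInducedStrength s T t) :
    t = (inducedStrength s T).app := by
  funext X Y
  exact IsTensorHom.ext (x := X.hom) (T _).isCia (ht X Y).1 (isTensorHom_inducedApp s T X Y)
    ((ht X Y).2.trans (unit_inducedApp s T X Y).symm)

end InducedStrength

/-! ### The initial completely iterative `H`-monoid -/

section InitialMonoid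

variable {C : Type u} [Category.{v} C] [MonoidalCategory C] [HasBinaryCoproducts C]
  [∀ W : C, PreservesFiniteCoproducts (tensorRight W)]
  {H : C ⥤ C} (s : PointStrength H) (T : ∀ X : C, FreeCia H X)
  [∀ X, IsIso (coprod.desc (T X).alg.str (T X).unit)]

/-- The free completely iterative algebra on the unit object, pointed by its unit. -/
abbrev freePt : Under (𝟙_ C) := Under.mk (T (𝟙_ C)).unit

/-- The algebra homomorphism underlying the multiplication of the monad. -/
noncomputable abbrev joinHom (X : C) : (T (T X).alg.a).alg ⟶ (T X).alg :=
  (T (T X).alg.a).lift (T X).isCia (𝟙 _)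

/-- The multiplication of the free completely iterative algebra on the unit object. -/
noncomputable def freeMul :
    (T (𝟙_ C)).alg.a ⊗ (T (𝟙_ C)).alg.a ⟶ (T (𝟙_ C)).alg.a :=
  inducedApp s T (unitPt C) (freePt T) ≫ (mapHom T (λ_ (T (𝟙_ C)).alg.a).hom ≫ joinHom T _).f

lemma isTensorHom_freeMul : IsTensorHom s (T (𝟙_ C)).unit (freePt T) (freeMul s T) := by
  have h := (isTensorHom_inducedApp s T (unitPt C) (freePt T)).comp
    (mapHom T (λ_ (T (𝟙_ C)).alg.a).hom ≫ joinHom T _)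
  have e : (unitPt C).hom ≫ (T (𝟙_ C)).unit = (T (𝟙_ C)).unit := Category.id_comp _
  exact e ▸ h

lemma unit_freeMul :
    ((T (𝟙_ C)).unit ▷ (T (𝟙_ C)).alg.a) ≫ freeMul s T = (λ_ (T (𝟙_ C)).alg.a).hom := by
  have h := unit_inducedApp s T (unitPt C) (freePt T)
  dsimp at h
  rw [freeMul, reassoc_of% h, Algebra.comp_f, unit_mapHom_assoc]
  erw [(T _).unit_lift]
  exact Category.comp_id _

variable {s T} in
/-- Uniqueness of homomorphisms in the first variable, for the pointing of `TI` by its unit. -/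
lemma IsTensorHom.ext_unit {Y : Under (𝟙_ C)} {B : Algebra H} (hB : IsCia B)
    {f f' : (T (𝟙_ C)).alg.a ⊗ Y.right ⟶ B.a} (hf : IsTensorHom s (T (𝟙_ C)).unit Y f)
    (hf' : IsTensorHom s (T (𝟙_ C)).unit Y f')
    (h : ((T (𝟙_ C)).unit ▷ Y.right) ≫ f = ((T (𝟙_ C)).unit ▷ Y.right) ≫ f') : f = f' := by
  rw [← Category.id_comp (T (𝟙_ C)).unit] at hf hf'
  exact hf.ext hB hf' h

lemma pt_freeMul :
    (λ_ (𝟙_ C)).inv ≫ ((T (𝟙_ C)).unit ⊗ₘ (T (𝟙_ C)).unit) ≫ freeMul s T = (T (𝟙_ C)).unit := by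
  rw [MonoidalCategory.tensorHom_def', Category.assoc, unit_freeMul, leftUnitor_naturality,
    Iso.inv_hom_id_assoc]

/-- The monoid structure on the free completely iterative algebra on the unit object. -/
@[reducible]
noncomputable def freeMon : MonObj (T (𝟙_ C)).alg.a where
  one := (T (𝟙_ C)).unit
  mul := freeMul s T
  one_mul := unit_freeMul s T
  mul_one := by
    let v : unitPt C ⟶ freePt T := Under.homMk (T (𝟙_ C)).unit (Category.id_comp _)
    refine IsTensorHom.ext_unit (Y := unitPt C) (T _).isCia
      ((isTensorHom_freeMul s T).whiskerLeft_comp v) (IsTensorHom.rightUnitor s _) ?_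
    dsimp [v]
    rw [← whisker_exchange_assoc, unit_freeMul, leftUnitor_naturality, rightUnitor_naturality,
      unitors_equal]
  mul_assoc := by
    let v : tensorPt (freePt T) (freePt T) ⟶ freePt T :=
      Under.homMk (freeMul s T) ((Category.assoc _ _ _).trans (pt_freeMul s T))
    rw [← Iso.inv_comp_eq]
    refine IsTensorHom.ext_unit (Y := tensorPt (freePt T) (freePt T)) (T _).isCia
      ((isTensorHom_freeMul s T).assoc (pt_freeMul s T) (isTensorHom_freeMul s T))
      ((isTensorHom_freeMul s T).whiskerLeft_comp v) ?_
    dsimp [v]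
    rw [associator_inv_naturality_left_assoc, ← comp_whiskerRight_assoc, unit_freeMul,
      ← whisker_exchange_assoc, unit_freeMul, leftUnitor_naturality, leftUnitor_whiskerRight,
      Category.assoc, Iso.inv_hom_id_assoc]

/-- The free completely iterative algebra on the unit object as an `H`-monoid. -/
noncomputable abbrev freeHMonoid : HMonoid s where
  alg := (T (𝟙_ C)).alg
  mon := freeMon s T
  isHMonoid := isTensorHom_freeMul s T

variable {s} in
/-- The algebra homomorphism extending the unit of a completely iterative `H`-monoid preserves
multiplication, since both composites are homomorphisms in the first variable. -/
lemma freeMul_lift {A : HMonoid s} (hA : IsCia A.alg) (h : (T (𝟙_ C)).alg ⟶ A.alg)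
    (hh : (T (𝟙_ C)).unit ≫ h.f = A.mon.one) :
    freeMul s T ≫ h.f = (h.f ⊗ₘ h.f) ≫ A.mon.mul := by
  let v : freePt T ⟶ Under.mk A.mon.one := Under.homMk h.f hh
  have hm : IsTensorHom s A.mon.one (Under.mk A.mon.one) A.mon.mul := A.isHMonoid
  rw [MonoidalCategory.tensorHom_def, Category.assoc]
  refine IsTensorHom.ext_unit (Y := freePt T) hA ((isTensorHom_freeMul s T).comp h)
    ((hm.whiskerLeft_comp v).whiskerRight_comp h hh) ?_
  dsimp
  rw [← comp_whiskerRight_assoc, hh, ← whisker_exchange_assoc, A.mon.one_mul,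
    leftUnitor_naturality, ← Category.assoc, unit_freeMul]

/-- The unique homomorphism from `freeHMonoid` to a completely iterative `H`-monoid. -/
noncomputable def freeHMonoidLift (A : HMonoid s) (hA : IsCia A.alg) : freeHMonoid s T ⟶ A where
  algHom := (T (𝟙_ C)).lift hA A.mon.one
  isMonHom :=
    letI := freeMon s T
    have hh : (T (𝟙_ C)).unit ≫ ((T (𝟙_ C)).lift hA A.mon.one).f = A.mon.one :=
      (T (𝟙_ C)).unit_lift hA _
    { one_hom := hh
      mul_hom := freeMul_lift T hA _ hh }

lemma freeHMonoid_hom_ext {A : HMonoid s} (hA : IsCia A.alg) (f g : freeHMonoid s T ⟶ A) :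
    f = g := by
  have hf := f.isMonHom.one_hom
  have hg := g.isMonHom.one_hom
  exact HMonoid.Hom.ext ((T (𝟙_ C)).hom_ext hA (hf.trans hg.symm))

/-- The `H`-monoid `freeHMonoid` is initial among the completely iterative ones. -/
noncomputable def isInitialFreeHMonoid :
    IsInitial (⟨freeHMonoid s T, (T (𝟙_ C)).isCia⟩ :
      (HMonoid.completelyIterative s).FullSubcategory) :=
  IsInitial.ofUniqueHom (fun A => ObjectProperty.homMk (freeHMonoidLift s T A.obj A.property))
    fun A _ => ObjectProperty.hom_ext _ (freeHMonoid_hom_ext s T A.property _ _)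

end InitialMonoid

end HMon

theorem theorem3p15 {C : Type u} [Category.{v} C] [MonoidalCategory C] [HMon.IsMonoidallyLFP C]
    (H : C ⥤ C) [PreservesFilteredColimits H] (s : HMon.PointStrength H) :
    (∀ X : C, Nonempty (HMon.FreeCia H X)) ∧
    ∀ T : ∀ X : C, HMon.FreeCia H X,
      ∃ t : HMon.PointStrength (HMon.FreeCia.monad T).toFunctor,
        HMon.IsInducedStrength s T t.app ∧
        (∀ t', HMon.IsInducedStrength s T t' → t' = t.app) ∧
        ∃ M : MonObj (T (𝟙_ C)).alg.a,
          M.one = (HMon.FreeCia.monad T).η.app (𝟙_ C) ∧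
          M.mul =
            t.app (HMon.unitPt C) (Under.mk ((HMon.FreeCia.monad T).η.app (𝟙_ C))) ≫
              (HMon.FreeCia.monad T).map (λ_ (T (𝟙_ C)).alg.a).hom ≫
              (HMon.FreeCia.monad T).μ.app (𝟙_ C) ∧
          ∃ hM : HMon.IsHMonoid s (T (𝟙_ C)).alg M,
            Nonempty (IsInitial
              (⟨⟨(T (𝟙_ C)).alg, M, hM⟩, (T (𝟙_ C)).isCia⟩ :
                (HMon.HMonoid.completelyIterative s).FullSubcategory)) := by
  have hterm (X : C) : HasTerminal (Endofunctor.Coalgebra (HMon.addConst H X)) :=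
    HMon.hasTerminal_coalgebra_addConst H X
  refine ⟨fun X => HMon.nonempty_freeCia, fun T => ?_⟩
  have (X : C) : IsIso (coprod.desc (T X).alg.str (T X).unit) := HMon.isIso_desc_of_freeCia (T X)
  have (W : C) : PreservesFiniteCoproducts (tensorRight W) := HMon.IsMonoidallyLFP.rightDistrib W
  exact ⟨HMon.inducedStrength s T, HMon.isInducedStrength_inducedStrength s T,
    fun t' ht' => HMon.eq_inducedStrength s T ht', HMon.freeMon s T, rfl, rfl,
    HMon.isTensorHom_freeMul s T, ⟨HMon.isInitialFreeHMonoid s T⟩⟩
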